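/- **Setting and notation.** Let $X$ be a real finite-dimensional Hilbert space, $\mathbb B(x;\delta)$ the closed ball of radius $\delta$ about $x$ (so that $\operatorname{int}\mathbb B(x;\delta)=\{z:\|z-x\|<\delta\}$; $\mathbb B(x;+\infty)=X$). Let $f\colon X\to\mathbb R$ be convex and differentiable with $L$-Lipschitz continuous gradient, $L\ge 0$. Let $g=\min_{i\in I}g_i\colon X\to(-\infty,+\infty]$ be min-convex, i.e. $I$ is a nonempty finite set and each $g_i\colon X\to(-\infty,+\infty]$ is proper, lower semicontinuous and convex. Let $\gamma\in(0,2/L)$ (with $2/0=+\infty$). For proper $h\colon X\to(-\infty,+\infty]$ write ${}^\gamma h(x)=\inf_{y\in X}\bigl(h(y)+\tfrac1{2\gamma}\|x-y\|^2\bigr)$ and $\operatorname{prox}_{\gamma h}(x)=\{y\in X: h(y)+\tfrac1{2\gamma}\|x-y\|^2={}^\gamma h(x)\}$; $\operatorname{argmin}h$ is the set of global minimizers of $h$. At points $x$ with $h(x)<+\infty$, the convex subdifferential $\partial h(x)$ is the set of $v$ with $h(x)+\langle v,y-x\rangle\le h(y)$ for all $y\in X$, and the proximal subdifferential $\partial_p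 h(x)$ is the set of $v$ for which there are $\mu,\delta>0$ with $\langle v,y-x\rangle\le h(y)-h(x)+\tfrac1{2\mu}\|y-x\|^2$ for all $y\in\mathbb B(x;\delta)$; both are empty if $h(x)=+\infty$. A local minimum of $h$ is a point $x$ with $h(x)<+\infty$ such that $h(x)\le h(y)$ for all $y$ near $x$. For a set-valued operator $T\colon X\rightrightarrows X$ put $\operatorname{Fix}T=\{x:x\in T(x)\}$ and $\mathbf{Fix}\,T=\{x:T(x)=\{x\}\}$ (strong fixed points). A map $S\colon X\to X$ is $\alpha$-averaged nonexpansive if $\alpha\in(0,1)$ and $\|Sx-Sy\|^2+\frac{1-\alpha}{\alpha}\|(x-Sx)-(y-Sy)\|^2\le\|x-y\|^2$ for all $x,y$. The operator $T$ is union $\alpha$-averaged nonexpansive if it has a representation $T(x)=\{T_k(x):k\in\varphi(x)\}$ $(x\in X)$ with a finite index set $K$, $\alpha$-averaged nonexpansive maps $T_k$ $(k\in K)$ and an active selector $\varphi\colon X\rightrightarrows K$ that is nonempty-valued and outer semicontinuous (if $u_n\to x$ and $k\in\varphi(u_n)$ for all $n$, then $k\in\varphi(x)$). With respect to such a representation,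 the radius of attraction at $x^*$ is $r(x^*;T)=\sup\{\delta>0:\varphi(x)\subseteq\varphi(x^*)\text{ for all }x\in\mathbb B(x^*;\delta)\}$. Let $T_{\rm FB}(x)=\operatorname{prox}_{\gamma g}(x-\gamma\nabla f(x))$ and $\phi(x)=\{i\in I:{}^\gamma g(x-\gamma\nabla f(x))={}^\gamma g_i(x-\gamma\nabla f(x))\}$. **Theorem (Properties of $T_{\rm FB}$ and forward-backward splitting).** (a) $T_{\rm FB}$ is union $\frac{2}{4-\gamma L}$-averaged nonexpansive. More precisely, each $\operatorname{prox}_{\gamma g_i}$ is single-valued, and $T_{\rm FB}(x)=\{\operatorname{prox}_{\gamma g_i}(x-\gamma\nabla f(x)):i\in\phi(x)\}$ is a representation of $T_{\rm FB}$ as a union $\frac{2}{4-\gamma L}$-averaged nonexpansive operator, with active selector $\phi$. (b) If $x\in\operatorname{Fix}T_{\rm FB}$, then there is an $i\in I$ with $0\in(\nabla f(x)+\partial_p g(x))\cap(\nabla f(x)+\partial g_i(x))$. (c) $x\in\operatorname{Fix}T_{\rm FB}$ if and only if there is an $i\in\phi(x)$ with $x\in\operatorname{argmin}(f+g_i)$;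 for every such $i$, $g(x)=g_i(x)$. (d) $x\in\mathbf{Fix}\,T_{\rm FB}$ if and only if $x\in\operatorname{argmin}(f+g_i)$ for all $i\in\phi(x)$; in that case $g(x)=g_i(x)$ for all $i\in\phi(x)$. (e) $\mathbf{Fix}\,T_{\rm FB}\subseteq\{x\in X:x\text{ is a local minimum of }f+g\}\cap\operatorname{Fix}T_{\rm FB}$. (f) If $x^*\in\mathbf{Fix}\,T_{\rm FB}$, then there is a $\delta>0$ such that every point of $\operatorname{Fix}T_{\rm FB}\cap\mathbb B(x^*;\delta)$ is a local minimum of $f+g$. (g) Let $x^*\in\mathbf{Fix}\,T_{\rm FB}$. There is a $\delta>0$ such that, for every representation of $T_{\rm FB}$ as a union $\frac{2}{4-\gamma L}$-averaged nonexpansive operator, with corresponding radius of attraction $r=r(x^*;T_{\rm FB})$, the following holds. First, $r\in(0,+\infty]$. Second, if $(\lambda_n)_{n\in\mathbb N}$ is a sequence in $\left(0,\frac{4-\gamma L}{2}\right]$ with $\liminf_{n\to\infty}\lambda_n\left(\frac{4-\gamma L}{2}-\lambda_n\right)>0$ and $(x_n)_{n\in\mathbb N}$ satisfies $x_0\in\operatorname{int}\mathbb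 B(x^*;r)$ and $x_{n+1}\in(1-\lambda_n)x_n+\lambda_nT_{\rm FB}(x_n)$ for all $n$, then $(x_n)$ converges to a point $\overline x\in\operatorname{Fix}T_{\rm FB}\cap\mathbb B(x^*;r)$; and if moreover $\|x_0-x^*\|<\delta$, then $\overline x$ is a local minimum of $f+g$. -/

import Mathlib

open Filter Topology
open scoped NNReal ENNReal Pointwise

noncomputable section

namespace UnionAveraged

/-! ### Set-valued operators and fixed points -/

/-- The fixed point set of a set-valued operator. -/
def fixSet {X : Type*} (T : X → Set X) : Set X := {x | x ∈ T x}

/-- The strong fixed point set of a set-valued operator. -/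
def strongFixSet {X : Type*} (T : X → Set X) : Set X := {x | T x = {x}}

section Operators

variable {X : Type*} [NormedAddCommGroup X]

/-- `S` is `α`-averaged nonexpansive. -/
def IsAveraged (α : ℝ) (S : X → X) : Prop :=
  0 < α ∧ α < 1 ∧
    ∀ x y, ‖S x - S y‖ ^ 2 + (1 - α) / α * ‖(x - S x) - (y - S y)‖ ^ 2 ≤ ‖x - y‖ ^ 2

/-- Outer semicontinuity at `x₀` of a set-valued map into a finite index set.  The index set
carries the discrete topology, so that `vₙ → i` means `vₙ = i` for all large `n`. -/
def IsOscAt {I : Type*} (φ : X → Set I) (x₀ : X) : Prop :=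
  ∀ (u : ℕ → X) (v : ℕ → I) (i : I), Tendsto u atTop (𝓝 x₀) → (∀ᶠ n in atTop, v n = i) →
    (∀ n, v n ∈ φ (u n)) → i ∈ φ x₀

/-- The finite family `S` of operators and the active selector `φ` represent `T` as a union
`α`-averaged nonexpansive operator. -/
structure IsUnionAveragedRepr {I : Type*} (α : ℝ) (T : X → Set X) (S : I → X → X)
    (φ : X → Set I) : Prop where
  finite : Finite I
  averaged : ∀ i, IsAveraged α (S i)
  osc : ∀ x, IsOscAt φ x
  nonempty : ∀ x, (φ x).Nonempty
  eq_image : ∀ x, T x = (fun i => S i x) '' φ x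

/-- `T` is union `α`-averaged nonexpansive. -/
def IsUnionAveraged (α : ℝ) (T : X → Set X) : Prop :=
  ∃ (m : ℕ) (S : Fin m → X → X) (φ : X → Set (Fin m)), IsUnionAveragedRepr α T S φ

/-- The radius of attraction at `xs` belonging to the active selector `φ`; it may be `∞`. -/
def attractionRadius {I : Type*} (φ : X → Set I) (xs : X) : ℝ≥0∞ :=
  sSup {r : ℝ≥0∞ | ∃ δ : ℝ, 0 < δ ∧ (∀ x ∈ Metric.closedBall xs δ, φ x ⊆ φ xs) ∧
    r = ENNReal.ofReal δ}

end Operators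

/-! ### Extended-real-valued functions -/

section Functions

variable {X : Type*} [NormedAddCommGroup X]

/-- `h` takes values in `(-∞, +∞]` and is not identically `+∞`. -/
def IsProper (h : X → EReal) : Prop := (∀ x, h x ≠ ⊥) ∧ ∃ x, h x ≠ ⊤

/-- The set of global minimizers. -/
def argmin (h : X → EReal) : Set X := {x | ∀ y, h x ≤ h y}

/-- `x` lies in the effective domain of `h` and minimizes `h` on a neighbourhood of `x`. -/
def IsLocalMinimum (h : X → EReal) (x : X) : Prop := h x ≠ ⊤ ∧ IsLocalMin h x

/-- The sum of a real-valued function and an extended-real-valued one. -/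
def addE (f : X → ℝ) (h : X → EReal) : X → EReal := fun x => (f x : EReal) + h x

/-- The Moreau envelope of `h` with parameter `γ`. -/
def moreau (γ : ℝ) (h : X → EReal) (x : X) : EReal :=
  ⨅ y : X, h y + ((1 / (2 * γ) * ‖x - y‖ ^ 2 : ℝ) : EReal)

/-- The (set-valued) proximity operator of `γ h`. -/
def prox (γ : ℝ) (h : X → EReal) (x : X) : Set X :=
  {y | h y + ((1 / (2 * γ) * ‖x - y‖ ^ 2 : ℝ) : EReal) = moreau γ h x}

variable [InnerProductSpace ℝ X]

/-- Convexity of an extended-real-valued function: its epigraph is convex. -/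
def IsConvexFun (h : X → EReal) : Prop :=
  Convex ℝ {p : X × ℝ | h p.1 ≤ (p.2 : EReal)}

/-- `g` is the pointwise minimum of the nonempty finite family `G` of proper, lower
semicontinuous, convex functions; in particular `g` is min-convex. -/
structure IsMinConvexRepr {I : Type*} (g : X → EReal) (G : I → X → EReal) : Prop where
  finite : Finite I
  nonempty : Nonempty I
  proper : ∀ i, IsProper (G i)
  lsc : ∀ i, LowerSemicontinuous (G i)
  convex : ∀ i, IsConvexFun (G i)
  eq_min : ∀ x, g x = ⨅ i, G i x

/-- The convex subdifferential, empty outside the effective domain. -/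
def subdiff (h : X → EReal) (x : X) : Set X :=
  {v | h x ≠ ⊤ ∧ ∀ y, h x + ((inner ℝ v (y - x) : ℝ) : EReal) ≤ h y}

/-- The proximal subdifferential, empty outside the effective domain. -/
def proxSubdiff (h : X → EReal) (x : X) : Set X :=
  {v | h x ≠ ⊤ ∧ ∃ γ > (0 : ℝ), ∃ δ > (0 : ℝ), ∀ y ∈ Metric.closedBall x δ,
    h x + ((inner ℝ v (y - x) : ℝ) : EReal) ≤
      h y + ((1 / (2 * γ) * ‖y - x‖ ^ 2 : ℝ) : EReal)}

variable [CompleteSpace X]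

/-- The forward step `x - γ ∇f(x)`. -/
def forward (γ : ℝ) (f : X → ℝ) (x : X) : X := x - γ • gradient f x

/-- The forward-backward operator `prox_{γ g} (Id - γ ∇f)`. -/
def fbOperator (γ : ℝ) (f : X → ℝ) (g : X → EReal) (x : X) : Set X :=
  prox γ g (forward γ f x)

/-- The indices `i` whose Moreau envelope agrees with that of `g` at `x - γ ∇f(x)`. -/
def fbSelector {I : Type*} (γ : ℝ) (f : X → ℝ) (g : X → EReal) (G : I → X → EReal) (x : X) :
    Set I :=
  {i | moreau γ g (forward γ f x) = moreau γ (G i) (forward γ f x)}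

end Functions

end UnionAveraged

end

open UnionAveraged

/-! The envelope of `g` is the minimum of the envelopes of the convex pieces `G i`, so a proximal
point of `g` is a proximal point of an active piece (`IsMinConvexRepr.mem_prox_iff`).  For one
piece, convexity and lower semicontinuity give a unique proximal point, and Fermat's rule
(`mem_argmin_addE_iff`) turns both "`p` is a proximal point" and "`p` minimizes `f + G i`" into
subgradient conditions.  At a point fixed by the forward-backward step of `G i` these two
conditions coincide (`mem_prox_forward_iff_argmin`), which characterizes fixed points and strong
fixed points.

The averagedness constant comes from combining cocoercivity of `∇f`
(`ConvexOn.norm_gradient_sub_sq_le`) with firm nonexpansiveness of the proximity operator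
(`norm_sub_sq_le_inner_of_mem_prox`); the selector is outer semicontinuous because Moreau
envelopes are continuous (`continuous_moreau`).  At a strong fixed point every active piece has a
global minimum of `f + G i`, while inactive pieces are strictly more expensive nearby, so `f + g`
has a local minimum there; fixed points nearby share the value of `f + g`
(`exists_closedBall_isLocalMinimum`).

For the iteration, only operators that fix `xs` are used within the radius of attraction, so the
iterates are Fejér monotone with respect to `xs` and the residuals vanish.  Near a cluster point,
vanishing residuals exclude every operator that moves it, so the iterates approach it monotonically
and converge (`exists_tendsto_relaxed`). -/

/-! ### Smooth convex functions -/

section Smooth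

variable {X : Type*} [NormedAddCommGroup X] [InnerProductSpace ℝ X] [CompleteSpace X]

theorem HasGradientAt.hasDerivAt_lineMap {f : X → ℝ} {x y v : X} {t : ℝ}
    (hf : HasGradientAt f v (AffineMap.lineMap x y t)) :
    HasDerivAt (fun s : ℝ => f (AffineMap.lineMap x y s)) (inner ℝ v (y - x)) t := by
  have h := hf.hasFDerivAt.comp_hasDerivAt t
    (AffineMap.hasDerivAt_lineMap (a := x) (b := y) (x := t))
  rw [InnerProductSpace.toDual_apply_apply] at h
  exact h

/-- A convex function lies above its tangents. -/
theorem ConvexOn.add_inner_le_of_hasGradientAt {f : X → ℝ} (hf : ConvexOn ℝ Set.univ f)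
    {x v : X} (hv : HasGradientAt f v x) (y : X) : f x + inner ℝ v (y - x) ≤ f y := by
  have hc : ConvexOn ℝ Set.univ (fun s : ℝ => f (AffineMap.lineMap x y s)) := by
    simpa [Function.comp_def] using hf.comp_affineMap (AffineMap.lineMap x y)
  have hd : HasDerivAt (fun s : ℝ => f (AffineMap.lineMap x y s)) (inner ℝ v (y - x)) 0 :=
    HasGradientAt.hasDerivAt_lineMap (by simpa using hv)
  have h := hc.le_slope_of_hasDerivAt (Set.mem_univ 0) (Set.mem_univ 1) zero_lt_one hd
  simp [slope_def_field] at h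
  linarith

/-- The quadratic upper bound for a function with Lipschitz gradient. -/
theorem le_add_inner_add_of_lipschitzWith_gradient {f : X → ℝ} {L : ℝ≥0}
    (hd : Differentiable ℝ f) (hL : LipschitzWith L (gradient f)) (x y : X) :
    f y ≤ f x + inner ℝ (gradient f x) (y - x) + L / 2 * ‖y - x‖ ^ 2 := by
  set φ : ℝ → ℝ := fun t => f (AffineMap.lineMap x y t) -
    (t * inner ℝ (gradient f x) (y - x) + t ^ 2 * (L / 2 * ‖y - x‖ ^ 2)) with hφ
  have hφd : ∀ t, HasDerivAt φ (inner ℝ (gradient f (AffineMap.lineMap x y t)) (y - x) -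
      (1 * inner ℝ (gradient f x) (y - x) + (2 * t) * (L / 2 * ‖y - x‖ ^ 2))) t := by
    intro t
    refine (HasGradientAt.hasDerivAt_lineMap (hd _).hasGradientAt).sub
      (((hasDerivAt_id t).mul_const _).add ?_)
    simpa using (hasDerivAt_pow 2 t).mul_const (L / 2 * ‖y - x‖ ^ 2)
  have hanti : AntitoneOn φ (Set.Icc 0 1) := by
    refine antitoneOn_of_deriv_nonpos (convex_Icc 0 1)
      (fun t _ => (hφd t).continuousAt.continuousWithinAt)
      (fun t _ => (hφd t).differentiableAt.differentiableWithinAt) (fun t ht => ?_)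
    rw [interior_Icc] at ht
    rw [(hφd t).deriv]
    have h1 : inner ℝ (gradient f (AffineMap.lineMap x y t) - gradient f x) (y - x) ≤
        t * L * ‖y - x‖ ^ 2 := by
      refine (real_inner_le_norm _ _).trans ?_
      have h2 := hL.dist_le_mul (AffineMap.lineMap x y t) x
      rw [dist_lineMap_left, dist_eq_norm, dist_comm, dist_eq_norm, Real.norm_of_nonneg ht.1.le]
        at h2
      nlinarith [norm_nonneg (y - x)]
    rw [inner_sub_left] at h1
    linarith
  have h := hanti (Set.left_mem_Icc.2 zero_le_one) (Set.right_mem_Icc.2 zero_le_one) zero_le_one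
  simp only [hφ, AffineMap.lineMap_apply_one, AffineMap.lineMap_apply_zero] at h
  linarith

/-- The Baillon-Haddad theorem: an `L`-Lipschitz gradient of a convex function is
`1 / L`-cocoercive. -/
theorem ConvexOn.norm_gradient_sub_sq_le {f : X → ℝ} {L : ℝ≥0} (hf : ConvexOn ℝ Set.univ f)
    (hd : Differentiable ℝ f) (hL : LipschitzWith L (gradient f)) (x y : X) :
    ‖gradient f x - gradient f y‖ ^ 2 ≤ L * inner ℝ (gradient f x - gradient f y) (x - y) := by
  rcases eq_or_ne L 0 with rfl | hL0
  · have h := hL.dist_le_mul x y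
    rw [dist_eq_norm] at h
    have h0 : ‖gradient f x - gradient f y‖ = 0 := le_antisymm (by simpa using h) (norm_nonneg _)
    simp [h0]
  have hpos : (0 : ℝ) < L := by positivity
  -- One half: compare the tangent at `x` with the quadratic bound at `y`, both evaluated at the
  -- point reached from `y` by a step of length `1 / L` against the gradient difference.
  have key : ∀ x y : X, f x + inner ℝ (gradient f x) (y - x) +
      ‖gradient f y - gradient f x‖ ^ 2 / (2 * L) ≤ f y := by
    intro x y
    set w := gradient f y - gradient f x with hw
    have h1 := hf.add_inner_le_of_hasGradientAt (hd x).hasGradientAt (y - (L : ℝ)⁻¹ • w)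
    have h2 := le_add_inner_add_of_lipschitzWith_gradient hd hL y (y - (L : ℝ)⁻¹ • w)
    have e1 : y - (L : ℝ)⁻¹ • w - x = (y - x) - (L : ℝ)⁻¹ • w := by abel
    have e2 : y - (L : ℝ)⁻¹ • w - y = -((L : ℝ)⁻¹ • w) := by abel
    have e3 : ‖w‖ ^ 2 = inner ℝ (gradient f y) w - inner ℝ (gradient f x) w := by
      rw [← inner_sub_left, ← hw, real_inner_self_eq_norm_sq]
    rw [e1, inner_sub_right, real_inner_smul_right] at h1
    rw [e2, inner_neg_right, real_inner_smul_right, norm_neg, norm_smul, mul_pow] at h2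
    have e4 : (L : ℝ) / 2 * (‖(L : ℝ)⁻¹‖ ^ 2 * ‖w‖ ^ 2) = (L : ℝ)⁻¹ * ‖w‖ ^ 2 / 2 := by
      rw [Real.norm_eq_abs, sq_abs]; field_simp
    have e5 : ‖w‖ ^ 2 / (2 * L) = (L : ℝ)⁻¹ * ‖w‖ ^ 2 / 2 := by field_simp
    have e6 : (L : ℝ)⁻¹ * ‖w‖ ^ 2 = (L : ℝ)⁻¹ * inner ℝ (gradient f y) w -
        (L : ℝ)⁻¹ * inner ℝ (gradient f x) w := by rw [e3]; ring
    rw [e4] at h2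
    rw [e5]
    linarith
  have h1 := key x y
  have h2 := key y x
  rw [norm_sub_rev] at h1
  have e : ‖gradient f x - gradient f y‖ ^ 2 / (2 * L) + ‖gradient f x - gradient f y‖ ^ 2 / (2 * L)
      = ‖gradient f x - gradient f y‖ ^ 2 / L := by field_simp; ring
  have e' : inner ℝ (gradient f x) (y - x) = - inner ℝ (gradient f x) (x - y) := by
    rw [← inner_neg_right, neg_sub]
  have h3 : ‖gradient f x - gradient f y‖ ^ 2 / L ≤
      inner ℝ (gradient f x - gradient f y) (x - y) := by
    rw [inner_sub_left]
    linarith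
  rw [div_le_iff₀ hpos] at h3
  linarith

end Smooth

/-! ### Extended-real-valued convex functions -/

namespace UnionAveraged

section EReal

theorem coe_le_of_forall_coe {c : ℝ} {e : EReal} (he : e ≠ ⊥)
    (H : ∀ r : ℝ, e = r → c ≤ r) : (c : EReal) ≤ e := by
  induction e with
  | bot => exact absurd rfl he
  | top => exact le_top
  | coe r => exact_mod_cast H r rfl

theorem exists_eq_coe {e : EReal} (h1 : e ≠ ⊥) (h2 : e ≠ ⊤) : ∃ r : ℝ, e = r :=
  ⟨e.toReal, (EReal.coe_toReal h2 h1).symm⟩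

end EReal

section Convex

theorem argmin_addE_ne_top {X : Type*} {F : X → ℝ} {h : X → EReal} (hp : IsProper h) {p : X}
    (hmin : p ∈ argmin (addE F h)) : h p ≠ ⊤ := by
  obtain ⟨q, hq⟩ := hp.2
  obtain ⟨b, hb⟩ := exists_eq_coe (hp.1 q) hq
  intro htop
  have h1 := hmin q
  simp only [addE, htop, hb] at h1
  rw [← EReal.coe_add, EReal.coe_add_top, top_le_iff] at h1
  exact EReal.coe_ne_top _ h1

variable {X : Type*} [NormedAddCommGroup X] [InnerProductSpace ℝ X]

theorem IsConvexFun.apply_lineMap_le {h : X → EReal} (hc : IsConvexFun h) {x y : X} {a b t : ℝ}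
    (ha : h x ≤ a) (hb : h y ≤ b) (ht0 : 0 ≤ t) (ht1 : t ≤ 1) :
    h (AffineMap.lineMap x y t) ≤ ((1 - t) * a + t * b : ℝ) := by
  have h1 := hc (x := (x, a)) ha (y := (y, b)) hb (sub_nonneg.2 ht1) ht0 (sub_add_cancel 1 t)
  simpa [AffineMap.lineMap_apply_module] using h1

variable [CompleteSpace X]

/-- Fermat's rule: `p` minimizes the sum of a smooth convex `F` and a convex `h` if and only if
`-∇F(p)` is a subgradient of `h` at `p`. -/
theorem mem_argmin_addE_iff {F : X → ℝ} {h : X → EReal} (hF : ConvexOn ℝ Set.univ F)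
    (hp : IsProper h) (hc : IsConvexFun h) {p v : X} (hv : HasGradientAt F v p) :
    p ∈ argmin (addE F h) ↔ -v ∈ subdiff h p := by
  constructor
  · intro hmin
    have hpt := argmin_addE_ne_top hp hmin
    refine ⟨hpt, fun y => ?_⟩
    obtain ⟨a, ha⟩ := exists_eq_coe (hp.1 p) hpt
    rw [ha, ← EReal.coe_add]
    refine coe_le_of_forall_coe (hp.1 y) fun b hb => ?_
    -- `F + h` is bounded above on the segment from `p` to `y` by the differentiable function
    -- `φ`, which therefore has a nonnegative derivative at `0`.
    set φ : ℝ → ℝ := fun t => F (AffineMap.lineMap p y t) + t * (b - a) with hφ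
    have hd : HasDerivAt φ (inner ℝ v (y - p) + 1 * (b - a)) 0 :=
      (HasGradientAt.hasDerivAt_lineMap (by simpa using hv)).add
        ((hasDerivAt_id (0 : ℝ)).mul_const (b - a))
    have hslope := hd.tendsto_slope_zero_right
    have h0 : 0 ≤ inner ℝ v (y - p) + 1 * (b - a) := by
      refine ge_of_tendsto hslope ?_
      filter_upwards [Ioc_mem_nhdsGT (zero_lt_one (α := ℝ))] with t ht
      have h1 := hmin (AffineMap.lineMap p y t)
      have h2 := hc.apply_lineMap_le ha.le hb.le ht.1.le ht.2
      have h3 : ((F p + a : ℝ) : EReal) ≤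
          ((F (AffineMap.lineMap p y t) + ((1 - t) * a + t * b) : ℝ) : EReal) := by
        simp only [addE, ha] at h1
        rw [EReal.coe_add, EReal.coe_add]
        exact h1.trans (by gcongr)
      have h4 := EReal.coe_le_coe_iff.1 h3
      have h5 : 0 ≤ φ (0 + t) - φ 0 := by simp [hφ]; linarith
      exact smul_nonneg (inv_nonneg.2 ht.1.le) h5
    rw [inner_neg_left]
    linarith
  · rintro ⟨hpt, hsub⟩ y
    obtain ⟨a, ha⟩ := exists_eq_coe (hp.1 p) hpt
    have h1 := hF.add_inner_le_of_hasGradientAt hv y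
    have h2 := hsub y
    rw [ha, ← EReal.coe_add, inner_neg_left] at h2
    simp only [addE, ha]
    calc (F p : EReal) + a = ((F p + a : ℝ) : EReal) := (EReal.coe_add _ _).symm
      _ ≤ ((F y + (a + -inner ℝ v (y - p)) : ℝ) : EReal) := by
        rw [EReal.coe_le_coe_iff]; linarith
      _ ≤ F y + h y := by rw [EReal.coe_add]; gcongr

end Convex

/-! ### The proximity operator of a convex function -/

section Prox

theorem mem_prox_iff_forall_le {X : Type*} [NormedAddCommGroup X] {γ : ℝ} {h : X → EReal}
    {x p : X} :
    p ∈ prox γ h x ↔ ∀ y, h p + ((1 / (2 * γ) * ‖x - p‖ ^ 2 : ℝ) : EReal) ≤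
      h y + ((1 / (2 * γ) * ‖x - y‖ ^ 2 : ℝ) : EReal) := by
  refine ⟨fun hp y => ?_, fun hp => ?_⟩
  · rw [show _ = _ from hp]
    exact iInf_le _ y
  · exact le_antisymm (le_iInf hp) (iInf_le _ p)

theorem prox_eq_argmin {X : Type*} [NormedAddCommGroup X] (γ : ℝ) (h : X → EReal) (x : X) :
    prox γ h x = argmin (addE (fun y => 1 / (2 * γ) * ‖x - y‖ ^ 2) h) := by
  ext p
  simp only [mem_prox_iff_forall_le, argmin, addE, Set.mem_ofPred_eq, add_comm]

variable {X : Type*} [NormedAddCommGroup X] [InnerProductSpace ℝ X]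

theorem convexOn_mul_norm_sub_sq {c : ℝ} (hc : 0 ≤ c) (x : X) :
    ConvexOn ℝ Set.univ (fun y : X => c * ‖x - y‖ ^ 2) := by
  have h1 : ConvexOn ℝ Set.univ (fun y : X => dist y x) := convexOn_dist x convex_univ
  have h2 := (h1.pow (fun _ _ => dist_nonneg) 2).smul hc
  refine h2.congr fun y _ => ?_
  simp [dist_eq_norm, norm_sub_rev]

/-- A proper, lower semicontinuous, convex function on a finite-dimensional space decreases at
most linearly: with its minimum over a unit ball as a bound near the centre, convexity along rays
propagates the bound outwards. -/
theorem exists_linear_lower_bound [FiniteDimensional ℝ X] {h : X → EReal} (hp : IsProper h)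
    (hl : LowerSemicontinuous h) (hc : IsConvexFun h) {x₀ : X} {a : ℝ} (ha : h x₀ = a) :
    ∃ c : ℝ, 0 ≤ c ∧ ∀ y, ∀ b : ℝ, h y = b → a - c * (1 + ‖y - x₀‖) ≤ b := by
  obtain ⟨z, -, hz⟩ := (hl.lowerSemicontinuousOn (Metric.closedBall x₀ 1)).exists_isMinOn
    ⟨x₀, Metric.mem_closedBall_self zero_le_one⟩ (isCompact_closedBall x₀ 1)
  have hza : h z ≤ a := ha ▸ hz (Metric.mem_closedBall_self zero_le_one)
  obtain ⟨m, hm⟩ := exists_eq_coe (hp.1 z) (ne_top_of_le_ne_top (EReal.coe_ne_top a) hza)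
  rw [hm, EReal.coe_le_coe_iff] at hza
  refine ⟨a - m, sub_nonneg.2 hza, fun y b hb => ?_⟩
  rcases le_total ‖y - x₀‖ 1 with hy | hy
  · have h1 : h z ≤ h y := hz (by rwa [Metric.mem_closedBall, dist_eq_norm])
    rw [hm, hb, EReal.coe_le_coe_iff] at h1
    nlinarith [norm_nonneg (y - x₀)]
  · have hpos : 0 < ‖y - x₀‖ := one_pos.trans_le hy
    have h1 := hc.apply_lineMap_le ha.le hb.le (inv_nonneg.2 hpos.le) (inv_le_one_of_one_le₀ hy)
    have h2 : h z ≤ h (AffineMap.lineMap x₀ y ‖y - x₀‖⁻¹) := by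
      refine hz ?_
      rw [Metric.mem_closedBall, dist_lineMap_left, norm_inv, norm_norm, dist_comm, dist_eq_norm,
        inv_mul_cancel₀ hpos.ne']
    have h3 := h2.trans h1
    rw [hm, EReal.coe_le_coe_iff] at h3
    have h4 : ‖y - x₀‖⁻¹ * ‖y - x₀‖ = 1 := inv_mul_cancel₀ hpos.ne'
    have h5 := mul_le_mul_of_nonneg_right h3 hpos.le
    have h6 : ((1 - ‖y - x₀‖⁻¹) * a + ‖y - x₀‖⁻¹ * b) * ‖y - x₀‖ =
        ‖y - x₀‖ * a - (‖y - x₀‖⁻¹ * ‖y - x₀‖) * a + (‖y - x₀‖⁻¹ * ‖y - x₀‖) * b := by ring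
    rw [h6, h4] at h5
    nlinarith

theorem prox_nonempty [FiniteDimensional ℝ X] {γ : ℝ} (hγ : 0 < γ) {h : X → EReal}
    (hp : IsProper h) (hl : LowerSemicontinuous h) (hc : IsConvexFun h) (x : X) :
    (prox γ h x).Nonempty := by
  obtain ⟨x₀, hx₀⟩ := hp.2
  obtain ⟨a, ha⟩ := exists_eq_coe (hp.1 x₀) hx₀
  obtain ⟨c, hc0, hlow⟩ := exists_linear_lower_bound hp hl hc ha
  -- Outside the ball of radius `R` about `x₀`, the quadratic term beats the linear decrease.
  set R : ℝ := 1 + 2 * ‖x - x₀‖ + 4 * γ * c with hR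
  have hR1 : 1 ≤ R := by
    have := norm_nonneg (x - x₀)
    have : 0 ≤ 4 * γ * c := by positivity
    linarith
  have hlsc : LowerSemicontinuous
      (fun y => h y + ((1 / (2 * γ) * ‖x - y‖ ^ 2 : ℝ) : EReal)) := by
    refine hl.add' (Continuous.lowerSemicontinuous ?_) fun y =>
      EReal.continuousAt_add (Or.inr (EReal.coe_ne_bot _)) (Or.inr (EReal.coe_ne_top _))
    exact continuous_coe_real_ereal.comp (by fun_prop)
  have hmem : x₀ ∈ Metric.closedBall x₀ R := Metric.mem_closedBall_self (by linarith)
  obtain ⟨p, -, hpmin⟩ := (hlsc.lowerSemicontinuousOn (Metric.closedBall x₀ R)).exists_isMinOn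
    ⟨x₀, hmem⟩ (isCompact_closedBall x₀ R)
  refine ⟨p, mem_prox_iff_forall_le.2 fun y => ?_⟩
  by_cases hy : y ∈ Metric.closedBall x₀ R
  · exact hpmin hy
  refine (hpmin hmem).trans ?_
  simp only [ha]
  rw [← EReal.coe_add]
  have hyb : h y + ((1 / (2 * γ) * ‖x - y‖ ^ 2 : ℝ) : EReal) ≠ ⊥ := by
    rw [Ne, EReal.add_eq_bot_iff, not_or]
    exact ⟨hp.1 y, EReal.coe_ne_bot _⟩
  refine coe_le_of_forall_coe hyb fun r hr => ?_
  have hyt : h y ≠ ⊤ := by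
    intro ht
    rw [ht, EReal.top_add_coe] at hr
    exact EReal.coe_ne_top _ hr.symm
  obtain ⟨b, hb⟩ := exists_eq_coe (hp.1 y) hyt
  rw [hb, ← EReal.coe_add, EReal.coe_eq_coe_iff] at hr
  rw [← hr]
  have h1 := hlow y b hb
  rw [Metric.mem_closedBall, dist_eq_norm, not_le] at hy
  have h2 : ‖y - x₀‖ ≤ ‖x - y‖ + ‖x - x₀‖ := by
    have := norm_sub_le_norm_sub_add_norm_sub y x x₀
    rwa [norm_sub_rev y x] at this
  have hd := norm_nonneg (x - x₀)
  have hγc : 0 ≤ γ * c := by positivity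
  have h3 : (‖y - x₀‖ - ‖x - x₀‖) ^ 2 ≤ ‖x - y‖ ^ 2 :=
    pow_le_pow_left₀ (by linarith) (by linarith) 2
  have h4 : ‖x - x₀‖ ^ 2 + 2 * γ * (c * (1 + ‖y - x₀‖)) ≤ ‖x - y‖ ^ 2 := by
    nlinarith
  have h5 : 1 / (2 * γ) * ‖x - x₀‖ ^ 2 + c * (1 + ‖y - x₀‖) ≤ 1 / (2 * γ) * ‖x - y‖ ^ 2 := by
    have := mul_le_mul_of_nonneg_left h4 (show (0 : ℝ) ≤ 1 / (2 * γ) by positivity)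
    have e : 1 / (2 * γ) * (2 * γ * (c * (1 + ‖y - x₀‖))) = c * (1 + ‖y - x₀‖) := by
      field_simp
    rw [mul_add, e] at this
    exact this
  linarith

variable [CompleteSpace X]

theorem hasGradientAt_mul_norm_sub_sq {γ : ℝ} (hγ : 0 < γ) (x p : X) :
    HasGradientAt (fun y => 1 / (2 * γ) * ‖x - y‖ ^ 2) (-(γ⁻¹ • (x - p))) p := by
  rw [hasGradientAt_iff_hasFDerivAt]
  have h1 : HasFDerivAt (fun y : X => x - y) (-ContinuousLinearMap.id ℝ X) p := by
    simpa using (hasFDerivAt_id p).const_sub x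
  refine (h1.norm_sq.const_mul (1 / (2 * γ))).congr_fderiv ?_
  ext y
  simp
  field_simp
  ring

theorem mem_prox_iff_subdiff {γ : ℝ} (hγ : 0 < γ) {h : X → EReal} (hp : IsProper h)
    (hc : IsConvexFun h) {x p : X} : p ∈ prox γ h x ↔ γ⁻¹ • (x - p) ∈ subdiff h p := by
  rw [prox_eq_argmin, mem_argmin_addE_iff (convexOn_mul_norm_sub_sq (by positivity) x) hp hc
    (hasGradientAt_mul_norm_sub_sq hγ x p), neg_neg]

/-- The proximity operator is firmly nonexpansive. -/
theorem norm_sub_sq_le_inner_of_mem_prox {γ : ℝ} (hγ : 0 < γ) {h : X → EReal} (hp : IsProper h)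
    (hc : IsConvexFun h) {x y p q : X} (hpx : p ∈ prox γ h x) (hqy : q ∈ prox γ h y) :
    ‖p - q‖ ^ 2 ≤ inner ℝ (x - y) (p - q) := by
  obtain ⟨ht1, h1⟩ := (mem_prox_iff_subdiff hγ hp hc).1 hpx
  obtain ⟨ht2, h2⟩ := (mem_prox_iff_subdiff hγ hp hc).1 hqy
  obtain ⟨a, ha⟩ := exists_eq_coe (hp.1 p) ht1
  obtain ⟨b, hb⟩ := exists_eq_coe (hp.1 q) ht2
  have h3 := h1 q
  have h4 := h2 p
  rw [ha, hb, ← EReal.coe_add, EReal.coe_le_coe_iff, real_inner_smul_left] at h3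
  rw [ha, hb, ← EReal.coe_add, EReal.coe_le_coe_iff, real_inner_smul_left] at h4
  have h5 : γ⁻¹ * (inner ℝ (x - p) (q - p) + inner ℝ (y - q) (p - q)) ≤ 0 := by linarith
  have h6 : inner ℝ (x - p) (q - p) + inner ℝ (y - q) (p - q) ≤ 0 := by
    by_contra hneg
    exact absurd h5 (not_le.2 (mul_pos (inv_pos.2 hγ) (not_le.1 hneg)))
  have h7 : inner ℝ (x - p) (q - p) + inner ℝ (y - q) (p - q) =
      ‖p - q‖ ^ 2 - inner ℝ (x - y) (p - q) := by
    rw [← neg_sub p q, inner_neg_right, ← real_inner_self_eq_norm_sq]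
    simp only [inner_sub_left]
    ring
  linarith

theorem exists_prox_eq_singleton [FiniteDimensional ℝ X] {γ : ℝ} (hγ : 0 < γ) {h : X → EReal}
    (hp : IsProper h) (hl : LowerSemicontinuous h) (hc : IsConvexFun h) (x : X) :
    ∃ p, prox γ h x = {p} := by
  obtain ⟨p, hpx⟩ := prox_nonempty hγ hp hl hc x
  refine ⟨p, Set.eq_singleton_iff_unique_mem.2 ⟨hpx, fun q hqx => ?_⟩⟩
  have h1 := norm_sub_sq_le_inner_of_mem_prox hγ hp hc hqx hpx
  rw [sub_self, inner_zero_left] at h1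
  exact sub_eq_zero.1 (norm_eq_zero.1 (pow_eq_zero_iff two_ne_zero |>.1
    (le_antisymm h1 (sq_nonneg _))))

end Prox

section Envelope

variable {X : Type*} [NormedAddCommGroup X] [InnerProductSpace ℝ X] [CompleteSpace X]

theorem continuous_of_prox_eq_singleton {γ : ℝ} (hγ : 0 < γ) {h : X → EReal} (hp : IsProper h)
    (hc : IsConvexFun h) {P : X → X} (hP : ∀ x, prox γ h x = {P x}) : Continuous P := by
  refine (LipschitzWith.of_dist_le_mul (K := 1) fun x y => ?_).continuous
  have hmem : ∀ x, P x ∈ prox γ h x := fun x => by simp [hP x]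
  have h1 := norm_sub_sq_le_inner_of_mem_prox hγ hp hc (hmem x) (hmem y)
  have h2 := real_inner_le_norm (x - y) (P x - P y)
  rw [dist_eq_norm, dist_eq_norm, NNReal.coe_one, one_mul]
  by_contra! hlt
  nlinarith [norm_nonneg (x - y)]

/-- The Moreau envelope of a proper, lower semicontinuous, convex function is continuous. -/
theorem continuous_moreau [FiniteDimensional ℝ X] {γ : ℝ} (hγ : 0 < γ) {h : X → EReal}
    (hp : IsProper h) (hl : LowerSemicontinuous h) (hc : IsConvexFun h) :
    Continuous (moreau γ h) := by
  choose P hP using exists_prox_eq_singleton hγ hp hl hc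
  have hmem : ∀ x, P x ∈ prox γ h x := fun x => by simp [hP x]
  have hcont := continuous_of_prox_eq_singleton hγ hp hc hP
  have hfin : ∀ x, ∃ r : ℝ, h (P x) = r := fun x =>
    exists_eq_coe (hp.1 _) ((mem_prox_iff_subdiff hγ hp hc).1 (hmem x)).1
  choose a ha using hfin
  set e : X → ℝ := fun x => a x + 1 / (2 * γ) * ‖x - P x‖ ^ 2 with he
  have hme : moreau γ h = fun x => (e x : EReal) := by
    funext x
    rw [← show _ = _ from hmem x, ha, ← EReal.coe_add]
  have hle : ∀ x y, e x ≤ e y + (1 / (2 * γ) * ‖x - P y‖ ^ 2 - 1 / (2 * γ) * ‖y - P y‖ ^ 2) := by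
    intro x y
    have h1 := mem_prox_iff_forall_le.1 (hmem x) (P y)
    rw [ha, ha, ← EReal.coe_add, ← EReal.coe_add, EReal.coe_le_coe_iff] at h1
    simp only [he]
    linarith
  rw [hme]
  refine continuous_coe_real_ereal.comp (continuous_iff_continuousAt.2 fun x => ?_)
  refine tendsto_of_tendsto_of_tendsto_of_le_of_le
    (g := fun y => e x - (1 / (2 * γ) * ‖x - P y‖ ^ 2 - 1 / (2 * γ) * ‖y - P y‖ ^ 2))
    (h := fun y => e x + (1 / (2 * γ) * ‖y - P x‖ ^ 2 - 1 / (2 * γ) * ‖x - P x‖ ^ 2))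
    ?_ ?_ (fun y => ?_) (fun y => hle y x)
  · have : Continuous
        fun y => e x - (1 / (2 * γ) * ‖x - P y‖ ^ 2 - 1 / (2 * γ) * ‖y - P y‖ ^ 2) := by fun_prop
    simpa using this.tendsto x
  · have : Continuous
        fun y => e x + (1 / (2 * γ) * ‖y - P x‖ ^ 2 - 1 / (2 * γ) * ‖x - P x‖ ^ 2) := by fun_prop
    simpa using this.tendsto x
  · have := hle x y
    simp only
    linarith

end Envelope

/-! ### Relaxed iterations of union averaged operators -/

section Iteration

variable {X : Type*} [NormedAddCommGroup X]

theorem IsOscAt.eventually_subset {I : Type*} [Finite I] {φ : X → Set I} {x₀ : X}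
    (h : IsOscAt φ x₀) : ∀ᶠ x in 𝓝 x₀, φ x ⊆ φ x₀ := by
  have h1 : ∀ i, ∀ᶠ x in 𝓝 x₀, i ∈ φ x → i ∈ φ x₀ := by
    intro i
    by_contra hi
    obtain ⟨u, hu, hui⟩ := exists_seq_forall_of_frequently (not_eventually.1 hi)
    refine (Classical.not_imp.1 (hui 0)).2
      (h u (fun _ => i) i hu (.of_forall fun _ => rfl) fun n => (Classical.not_imp.1 (hui n)).1)
  filter_upwards [eventually_all.2 h1] with x hx i hi using hx i hi

theorem attractionRadius_pos {I : Type*} [Finite I] {φ : X → Set I} {xs : X}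
    (h : IsOscAt φ xs) : 0 < attractionRadius φ xs := by
  obtain ⟨δ, hδ, hsub⟩ := Metric.nhds_basis_closedBall.eventually_iff.1 h.eventually_subset
  exact (ENNReal.ofReal_pos.2 hδ).trans_le (le_sSup ⟨δ, hδ, fun x hx => hsub hx, rfl⟩)

theorem selector_subset_of_edist_lt {I : Type*} {φ : X → Set I} {x xs : X}
    (h : edist x xs < attractionRadius φ xs) : φ x ⊆ φ xs := by
  obtain ⟨r, ⟨δ, hδ, hsub, rfl⟩, hr⟩ := lt_sSup_iff.1 h
  refine hsub x ?_
  rw [edist_dist, ENNReal.ofReal_lt_ofReal_iff hδ] at hr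
  exact hr.le

theorem IsAveraged.continuous {α : ℝ} {S : X → X} (h : IsAveraged α S) : Continuous S := by
  refine (LipschitzWith.of_dist_le_mul (K := 1) fun x y => ?_).continuous
  obtain ⟨h0, h1, h2⟩ := h
  have h3 : 0 ≤ (1 - α) / α * ‖(x - S x) - (y - S y)‖ ^ 2 :=
    mul_nonneg (div_nonneg (by linarith) h0.le) (sq_nonneg _)
  rw [dist_eq_norm, dist_eq_norm, NNReal.coe_one, one_mul]
  exact le_of_sq_le_sq (by linarith [h2 x y]) (norm_nonneg _)

variable [InnerProductSpace ℝ X]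

/-- The decrease of the distance to a fixed point in one relaxed step. -/
theorem IsAveraged.norm_relaxed_sub_sq_le {α : ℝ} {S : X → X} (h : IsAveraged α S) {z : X}
    (hz : S z = z) {t : ℝ} (ht : 0 ≤ t) (x : X) :
    ‖(1 - t) • x + t • S x - z‖ ^ 2 ≤ ‖x - z‖ ^ 2 - t * (α⁻¹ - t) * ‖x - S x‖ ^ 2 := by
  obtain ⟨h0, h1, h2⟩ := h
  have h3 := h2 x z
  rw [hz, sub_self, sub_zero] at h3
  have e1 : (1 - t) • x + t • S x - z = (x - z) - t • (x - S x) := by module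
  have e2 : S x - z = (x - z) - (x - S x) := by abel
  have e3 : (1 - α) / α = α⁻¹ - 1 := by field_simp
  rw [e2, norm_sub_sq_real, e3] at h3
  rw [e1, norm_sub_sq_real, norm_smul, mul_pow, real_inner_smul_right, Real.norm_eq_abs, sq_abs]
  nlinarith

theorem IsAveraged.dist_relaxed_le {α : ℝ} {S : X → X} (h : IsAveraged α S) {z : X}
    (hz : S z = z) {t : ℝ} (ht : t ∈ Set.Ioc 0 α⁻¹) (x : X) :
    dist ((1 - t) • x + t • S x) z ≤ dist x z := by
  have h1 := h.norm_relaxed_sub_sq_le hz ht.1.le x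
  have h2 : 0 ≤ t * (α⁻¹ - t) * ‖x - S x‖ ^ 2 :=
    mul_nonneg (mul_nonneg ht.1.le (sub_nonneg.2 ht.2)) (sq_nonneg _)
  rw [dist_eq_norm, dist_eq_norm]
  exact le_of_sq_le_sq (by linarith) (norm_nonneg _)

/-- A relaxed iteration of finitely many averaged operators with a common fixed point, used in
any order, converges.  The residuals tend to zero, so near a cluster point `y` only operators that
fix `y` can be used; the distance to `y` is then eventually nonincreasing. -/
theorem exists_tendsto_relaxed [FiniteDimensional ℝ X] {α : ℝ} {K : Type*} [Finite K]
    {S : K → X → X} (hS : ∀ k, IsAveraged α (S k)) {xs : X} {lam : ℕ → ℝ} {x : ℕ → X} {k : ℕ → K}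
    (hlam : ∀ n, lam n ∈ Set.Ioc 0 α⁻¹)
    (hliminf : 0 < liminf (fun n => lam n * (α⁻¹ - lam n)) atTop)
    (hx : ∀ n, x (n + 1) = (1 - lam n) • x n + lam n • S (k n) (x n))
    (hfix : ∀ n, S (k n) xs = xs) :
    ∃ y, Tendsto x atTop (𝓝 y) ∧ ∀ᶠ n in atTop, S (k n) y = y := by
  have hanti : Antitone fun n => dist (x n) xs := antitone_nat_of_succ_le fun n => by
    rw [hx n]; exact (hS _).dist_relaxed_le (hfix n) (hlam n) _
  have hres : Tendsto (fun n => ‖x n - S (k n) (x n)‖) atTop (𝓝 0) := by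
    have hnn : ∀ n, 0 ≤ lam n * (α⁻¹ - lam n) := fun n =>
      mul_nonneg (hlam n).1.le (sub_nonneg.2 (hlam n).2)
    obtain ⟨c, hc0, hc⟩ := exists_between hliminf
    have hev := eventually_lt_of_lt_liminf hc (isBoundedUnder_of ⟨0, hnn⟩)
    have hD := tendsto_atTop_ciInf hanti ⟨0, by rintro _ ⟨n, rfl⟩; exact dist_nonneg⟩
    have hdiff : Tendsto
        (fun n => c⁻¹ * (dist (x n) xs ^ 2 - dist (x (n + 1)) xs ^ 2)) atTop (𝓝 0) := by
      simpa using ((hD.pow 2).sub (((tendsto_add_atTop_iff_nat 1).2 hD).pow 2)).const_mul c⁻¹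
    have hsq : Tendsto (fun n => ‖x n - S (k n) (x n)‖ ^ 2) atTop (𝓝 0) := by
      refine squeeze_zero' (.of_forall fun n => sq_nonneg _) ?_ hdiff
      filter_upwards [hev] with n hn
      have h1 := (hS (k n)).norm_relaxed_sub_sq_le (hfix n) (hlam n).1.le (x n)
      rw [← hx n, ← dist_eq_norm, ← dist_eq_norm] at h1
      have h2 := mul_le_mul_of_nonneg_right hn.le (sq_nonneg ‖x n - S (k n) (x n)‖)
      rw [inv_mul_eq_div, le_div_iff₀ hc0]
      linarith
    simpa [Real.sqrt_sq_eq_abs] using hsq.sqrt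
  obtain ⟨y, -, σ, hσ, hσy⟩ := (isCompact_closedBall xs (dist (x 0) xs)).tendsto_subseq
    (x := x) fun n => hanti (Nat.zero_le n)
  -- An operator that moves `y` has residuals bounded away from zero near `y`, so an operator
  -- whose residual is at most that of a late iterate must fix `y`.
  have hnear : ∀ᶠ p in 𝓝 y ×ˢ (atTop : Filter ℕ), ∀ j,
      ‖p.1 - S j p.1‖ ≤ ‖x p.2 - S (k p.2) (x p.2)‖ → S j y = y := by
    refine eventually_all.2 fun j => ?_
    by_cases hj : S j y = y
    · exact .of_forall fun _ _ => hj
    have hcj : Continuous fun z => ‖z - S j z‖ := by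
      have := (hS j).continuous
      fun_prop
    have hlt := (hres.comp tendsto_snd).eventually_lt ((hcj.tendsto y).comp tendsto_fst)
      (norm_pos_iff.2 (sub_ne_zero.2 (Ne.symm hj)))
    filter_upwards [hlt] with p hp hle
    exact absurd hle (not_le.2 hp)
  obtain ⟨p, hp, q, hq, hpq⟩ := eventually_prod_iff.1 hnear
  obtain ⟨ε, hε, hpε⟩ := Metric.eventually_nhds_iff.1 hp
  obtain ⟨N, hN⟩ := eventually_atTop.1 hq
  have hused : ∀ n ≥ N, dist (x n) y < ε → S (k n) y = y := fun n hn hd =>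
    hpq (hpε hd) (hN n hn) (k n) le_rfl
  have hstay : ∀ m ≥ N, dist (x m) y < ε → ∀ n ≥ m, dist (x n) y ≤ dist (x m) y := by
    intro m hm hd n hn
    induction n, hn using Nat.le_induction with
    | base => exact le_rfl
    | succ n hn ih =>
      rw [hx n]
      exact ((hS _).dist_relaxed_le (hused n (hm.trans hn) (ih.trans_lt hd)) (hlam n) _).trans ih
  have htend : Tendsto x atTop (𝓝 y) := by
    rw [Metric.tendsto_atTop]
    intro η hη
    obtain ⟨j, hj, hjN⟩ := ((Metric.tendsto_nhds.1 hσy (min ε η) (lt_min hε hη)).and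
      (hσ.tendsto_atTop.eventually_ge_atTop N)).exists
    exact ⟨σ j, fun n hn => (hstay (σ j) hjN (hj.trans_le (min_le_left _ _)) n hn).trans_lt
      (hj.trans_le (min_le_right _ _))⟩
  refine ⟨y, htend, ?_⟩
  filter_upwards [eventually_ge_atTop N, Metric.tendsto_nhds.1 htend ε hε] with n hn hd
  exact hused n hn hd

/-- Started within the radius of attraction of a strong fixed point, a relaxed iteration of a
union averaged operator converges to a fixed point, since only operators that are active at
the strong fixed point, and hence leave it fixed, are ever used. -/
theorem IsUnionAveragedRepr.exists_tendsto_fixSet [FiniteDimensional ℝ X] {α : ℝ} {T : X → Set X}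
    {K : Type*} {S : K → X → X} {φ : X → Set K} (h : IsUnionAveragedRepr α T S φ) {xs : X}
    (hxs : xs ∈ strongFixSet T) {lam : ℕ → ℝ} {x : ℕ → X} (hlam : ∀ n, lam n ∈ Set.Ioc 0 α⁻¹)
    (hliminf : 0 < liminf (fun n => lam n * (α⁻¹ - lam n)) atTop)
    (hx : ∀ n, x (n + 1) ∈ {(1 - lam n) • x n} + lam n • T (x n))
    (hx0 : edist (x 0) xs < attractionRadius φ xs) :
    ∃ y ∈ fixSet T, edist y xs ≤ edist (x 0) xs ∧ Tendsto x atTop (𝓝 y) := by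
  have := h.finite
  have hstep : ∀ n, ∃ k ∈ φ (x n), x (n + 1) = (1 - lam n) • x n + lam n • S k (x n) := by
    intro n
    obtain ⟨u, hu, v, hv, huv⟩ := Set.mem_add.1 (hx n)
    obtain ⟨w, hw, rfl⟩ := Set.mem_smul_set.1 hv
    rw [h.eq_image] at hw
    obtain ⟨k, hk, rfl⟩ := hw
    rw [Set.mem_singleton_iff.1 hu] at huv
    exact ⟨k, hk, huv.symm⟩
  choose k hk hxk using hstep
  have hfix : ∀ z, edist z xs < attractionRadius φ xs → ∀ i ∈ φ z, S i xs = xs := by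
    intro z hz i hi
    have h1 : S i xs ∈ T xs := by
      rw [h.eq_image]
      exact ⟨i, selector_subset_of_edist_lt hz hi, rfl⟩
    rwa [show T xs = {xs} from hxs] at h1
  have hdist : ∀ n, edist (x n) xs ≤ edist (x 0) xs := by
    intro n
    induction n with
    | zero => exact le_rfl
    | succ n ih =>
      refine le_trans ?_ ih
      rw [hxk n, edist_dist, edist_dist]
      exact ENNReal.ofReal_le_ofReal ((h.averaged _).dist_relaxed_le
        (hfix _ (ih.trans_lt hx0) _ (hk n)) (hlam n) _)
  obtain ⟨y, hy, hev⟩ := exists_tendsto_relaxed h.averaged hlam hliminf hxk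
    fun n => hfix _ ((hdist n).trans_lt hx0) _ (hk n)
  refine ⟨y, ?_, le_of_tendsto' (hy.edist tendsto_const_nhds) hdist, hy⟩
  obtain ⟨n, hn, hsub⟩ := (hev.and (hy.eventually (h.osc y).eventually_subset)).exists
  rw [fixSet, Set.mem_ofPred_eq, h.eq_image]
  exact ⟨k n, hsub (hk n), hn⟩

end Iteration

/-! ### Proximity operators of min-convex functions -/

section MinConvex

variable {X : Type*} [NormedAddCommGroup X] [InnerProductSpace ℝ X] {I : Type*}
  {g : X → EReal} {G : I → X → EReal}

theorem IsMinConvexRepr.apply_le (hg : IsMinConvexRepr g G) (i : I) (x : X) : g x ≤ G i x :=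
  hg.eq_min x ▸ iInf_le _ i

theorem IsMinConvexRepr.exists_apply_eq (hg : IsMinConvexRepr g G) (x : X) :
    ∃ i, g x = G i x := by
  have := hg.finite
  have := hg.nonempty
  obtain ⟨i, hi⟩ := Finite.exists_min fun i => G i x
  exact ⟨i, le_antisymm (hg.apply_le i x) (hg.eq_min x ▸ le_iInf hi)⟩

theorem IsMinConvexRepr.moreau_le (hg : IsMinConvexRepr g G) (γ : ℝ) (i : I) (z : X) :
    moreau γ g z ≤ moreau γ (G i) z :=
  iInf_mono fun y => add_le_add_left (hg.apply_le i y) _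

/-- The Moreau envelope of a minimum is attained by one of the envelopes. -/
theorem IsMinConvexRepr.exists_moreau_eq (hg : IsMinConvexRepr g G) (γ : ℝ) (z : X) :
    ∃ i, moreau γ g z = moreau γ (G i) z := by
  have := hg.finite
  have := hg.nonempty
  obtain ⟨i, hi⟩ := Finite.exists_min fun i => moreau γ (G i) z
  refine ⟨i, le_antisymm (hg.moreau_le γ i z) (le_iInf fun y => ?_)⟩
  obtain ⟨j, hj⟩ := hg.exists_apply_eq y
  rw [hj]
  exact (hi j).trans (iInf_le _ y)

theorem IsMinConvexRepr.mem_prox_of_moreau_eq (hg : IsMinConvexRepr g G) {γ : ℝ} {z p : X} {i : I}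
    (hi : moreau γ g z = moreau γ (G i) z) (hp : p ∈ prox γ (G i) z) :
    p ∈ prox γ g z ∧ g p = G i p := by
  have hp' : G i p + _ = moreau γ (G i) z := hp
  have h1 : g p + ((1 / (2 * γ) * ‖z - p‖ ^ 2 : ℝ) : EReal) = moreau γ g z := by
    refine le_antisymm ?_ (iInf_le _ p)
    rw [hi, ← hp']
    exact add_le_add_left (hg.apply_le i p) _
  refine ⟨h1, ?_⟩
  have h2 := congrArg (· - ((1 / (2 * γ) * ‖z - p‖ ^ 2 : ℝ) : EReal)) (h1.trans (hi.trans hp'.symm))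
  simpa only [EReal.add_sub_cancel_right] using h2

theorem IsMinConvexRepr.mem_prox_iff (hg : IsMinConvexRepr g G) {γ : ℝ} {z p : X} :
    p ∈ prox γ g z ↔ ∃ i, moreau γ g z = moreau γ (G i) z ∧ p ∈ prox γ (G i) z := by
  refine ⟨fun hp => ?_, fun ⟨i, hi, hp⟩ => (hg.mem_prox_of_moreau_eq hi hp).1⟩
  obtain ⟨i, hi⟩ := hg.exists_apply_eq p
  have hp' : g p + _ = moreau γ g z := hp
  rw [hi] at hp'
  have h1 : moreau γ g z = moreau γ (G i) z :=
    le_antisymm (hg.moreau_le γ i z) (hp' ▸ iInf_le _ p)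
  exact ⟨i, h1, hp'.trans h1⟩

end MinConvex

/-! ### The forward-backward operator -/

section ForwardBackward

theorem strongFixSet_subset_fixSet {X : Type*} {T : X → Set X} : strongFixSet T ⊆ fixSet T := fun x hx => by
  rw [fixSet, Set.mem_ofPred_eq, show T x = {x} from hx]
  rfl

variable {X : Type*} [NormedAddCommGroup X] [InnerProductSpace ℝ X]

/-- A cocoercive forward step followed by a firmly nonexpansive backward step is averaged.  Here
`a` and `p` stand for the differences of two arguments and of the two results, and `u` for `γ`
times the difference of the gradients. -/
theorem norm_sq_add_mul_norm_sub_sq_le {a u p : X} {β : ℝ} (hβ : 0 ≤ β)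
    (hu : ‖u‖ ^ 2 ≤ β * inner ℝ u a) (hp : ‖p‖ ^ 2 ≤ inner ℝ (a - u) p) :
    ‖p‖ ^ 2 + (2 - β) / 2 * ‖a - p‖ ^ 2 ≤ ‖a‖ ^ 2 := by
  rw [inner_sub_left] at hp
  have e1 : ‖a - p‖ ^ 2 = ‖a‖ ^ 2 - 2 * inner ℝ a p + ‖p‖ ^ 2 := norm_sub_sq_real a p
  have hmain : 0 ≤ β / 2 * ‖a - p‖ ^ 2 + 2 * inner ℝ u p := by
    rcases hβ.eq_or_lt with rfl | hβ'
    · have hu0 : u = 0 := by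
        rw [← norm_eq_zero, ← pow_eq_zero_iff two_ne_zero]
        exact le_antisymm (by simpa using hu) (sq_nonneg _)
      simp [hu0]
    · -- Completing the square, with `‖u‖ ^ 2` absorbed by cocoercivity.
      have h2 := sq_nonneg ‖β • (a - p) - (2 : ℝ) • u‖
      rw [norm_sub_sq_real, norm_smul, norm_smul, mul_pow, mul_pow, real_inner_smul_left,
        real_inner_smul_right, real_inner_comm, inner_sub_right, Real.norm_eq_abs, sq_abs,
        Real.norm_two] at h2
      have h3 : 0 ≤ β * (β / 2 * ‖a - p‖ ^ 2 + 2 * inner ℝ u p) := by nlinarith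
      exact nonneg_of_mul_nonneg_right h3 hβ'
  nlinarith

variable [CompleteSpace X]

theorem isAveraged_prox_forward {f : X → ℝ} {L : ℝ≥0} (hf : ConvexOn ℝ Set.univ f)
    (hd : Differentiable ℝ f) (hL : LipschitzWith L (gradient f)) {γ : ℝ} (hγ : 0 < γ)
    (hγL : γ * L < 2) {h : X → EReal} (hp : IsProper h) (hc : IsConvexFun h) {P : X → X}
    (hP : ∀ x, P x ∈ prox γ h x) :
    IsAveraged (2 / (4 - γ * L)) fun x => P (forward γ f x) := by
  have hβ : 0 ≤ γ * L := mul_nonneg hγ.le L.coe_nonneg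
  have hpos : 0 < 4 - γ * L := by linarith
  refine ⟨by positivity, by rw [div_lt_one hpos]; linarith, fun x y => ?_⟩
  have e : (1 - 2 / (4 - γ * L)) / (2 / (4 - γ * L)) = (2 - γ * L) / 2 := by
    field_simp
    ring
  rw [e, show x - P (forward γ f x) - (y - P (forward γ f y)) =
    (x - y) - (P (forward γ f x) - P (forward γ f y)) by abel]
  refine norm_sq_add_mul_norm_sub_sq_le (u := γ • (gradient f x - gradient f y)) hβ ?_ ?_
  · have h1 := hf.norm_gradient_sub_sq_le hd hL x y
    rw [norm_smul, mul_pow, Real.norm_eq_abs, sq_abs, real_inner_smul_left]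
    nlinarith [mul_le_mul_of_nonneg_left h1 (sq_nonneg γ)]
  · have h1 := norm_sub_sq_le_inner_of_mem_prox hγ hp hc (hP (forward γ f x)) (hP (forward γ f y))
    rwa [show forward γ f x - forward γ f y = x - y - γ • (gradient f x - gradient f y) by
      simp only [forward, smul_sub]; abel] at h1

theorem continuous_forward {f : X → ℝ} {L : ℝ≥0} (hL : LipschitzWith L (gradient f)) (γ : ℝ) :
    Continuous (forward γ f) :=
  continuous_id.sub (hL.continuous.const_smul γ)

theorem inv_smul_forward_sub {γ : ℝ} (hγ : 0 < γ) (f : X → ℝ) (x : X) :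
    γ⁻¹ • (forward γ f x - x) = -gradient f x := by
  rw [forward, sub_sub_cancel_left, smul_neg, smul_smul, inv_mul_cancel₀ hγ.ne', one_smul]

theorem mem_prox_forward_iff_argmin {f : X → ℝ} (hf : ConvexOn ℝ Set.univ f)
    (hd : Differentiable ℝ f) {γ : ℝ} (hγ : 0 < γ) {h : X → EReal} (hp : IsProper h)
    (hc : IsConvexFun h) (x : X) : x ∈ prox γ h (forward γ f x) ↔ x ∈ argmin (addE f h) := by
  rw [mem_prox_iff_subdiff hγ hp hc, inv_smul_forward_sub hγ,
    mem_argmin_addE_iff hf hp hc (hd x).hasGradientAt]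

variable {I : Type*} {g : X → EReal} {G : I → X → EReal} {f : X → ℝ} {γ : ℝ}

theorem mem_fbOperator_iff (hg : IsMinConvexRepr g G) {x p : X} :
    p ∈ fbOperator γ f g x ↔
      ∃ i ∈ fbSelector γ f g G x, p ∈ prox γ (G i) (forward γ f x) :=
  hg.mem_prox_iff

theorem mem_fixSet_fbOperator_iff (hg : IsMinConvexRepr g G) (hf : ConvexOn ℝ Set.univ f)
    (hd : Differentiable ℝ f) (hγ : 0 < γ) {x : X} :
    x ∈ fixSet (fbOperator γ f g) ↔
      ∃ i ∈ fbSelector γ f g G x, x ∈ argmin (addE f (G i)) := by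
  rw [fixSet, Set.mem_ofPred_eq, mem_fbOperator_iff hg]
  exact exists_congr fun i => and_congr_right fun _ =>
    mem_prox_forward_iff_argmin hf hd hγ (hg.proper i) (hg.convex i) x

theorem apply_eq_of_mem_argmin (hg : IsMinConvexRepr g G) (hf : ConvexOn ℝ Set.univ f)
    (hd : Differentiable ℝ f) (hγ : 0 < γ) {x : X} {i : I} (hi : i ∈ fbSelector γ f g G x)
    (hx : x ∈ argmin (addE f (G i))) : g x = G i x :=
  (hg.mem_prox_of_moreau_eq hi
    ((mem_prox_forward_iff_argmin hf hd hγ (hg.proper i) (hg.convex i) x).2 hx)).2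

theorem fbSelector_nonempty (hg : IsMinConvexRepr g G) (x : X) :
    (fbSelector γ f g G x).Nonempty :=
  hg.exists_moreau_eq γ _

theorem neg_gradient_mem_proxSubdiff (hγ : 0 < γ) {x : X} (hx : x ∈ fixSet (fbOperator γ f g))
    (htop : g x ≠ ⊤) (hbot : ∀ y, g y ≠ ⊥) : -gradient f x ∈ proxSubdiff g x := by
  refine ⟨htop, γ, hγ, 1, one_pos, fun y _ => ?_⟩
  obtain ⟨a, ha⟩ := exists_eq_coe (hbot x) htop
  have h1 := mem_prox_iff_forall_le.1 (show x ∈ prox γ g (forward γ f x) from hx) y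
  rw [ha, ← EReal.coe_add] at h1 ⊢
  induction hy : g y with
  | bot => exact absurd hy (hbot y)
  | top =>
    rw [EReal.top_add_coe]
    exact le_top
  | coe b =>
    rw [hy, ← EReal.coe_add, EReal.coe_le_coe_iff] at h1
    rw [← EReal.coe_add, EReal.coe_le_coe_iff]
    have e1 : forward γ f x - x = -(γ • gradient f x) := by simp [forward]
    have e2 : forward γ f x - y = -(γ • gradient f x) - (y - x) := by simp only [forward]; abel
    rw [e1, e2, norm_sub_sq_real, inner_neg_left, real_inner_smul_left] at h1
    have e3 : 1 / (2 * γ) * (2 * -(γ * inner ℝ (gradient f x) (y - x))) =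
        -inner ℝ (gradient f x) (y - x) := by field_simp
    rw [inner_neg_left]
    linarith

theorem apply_ne_top_of_mem_fixSet (hg : IsMinConvexRepr g G) (hf : ConvexOn ℝ Set.univ f)
    (hd : Differentiable ℝ f) (hγ : 0 < γ) {x : X} (hx : x ∈ fixSet (fbOperator γ f g)) :
    g x ≠ ⊤ := by
  obtain ⟨i, hi, hmin⟩ := (mem_fixSet_fbOperator_iff hg hf hd hγ).1 hx
  rw [apply_eq_of_mem_argmin hg hf hd hγ hi hmin]
  exact argmin_addE_ne_top (hg.proper i) hmin

/-- Pieces inactive at a fixed point `x` are irrelevant near `x`: the envelope of `G i` at the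
forward step exceeds the value `g x + ‖·‖² / (2γ)` attained at `x`, and the quadratic term is
continuous, so `f + G i` stays above `(f + g)(x)` on a neighbourhood. -/
theorem eventually_le_addE_of_notMem_fbSelector (hg : IsMinConvexRepr g G)
    (hf : ConvexOn ℝ Set.univ f) (hd : Differentiable ℝ f) (hγ : 0 < γ) {x : X}
    (hx : x ∈ fixSet (fbOperator γ f g)) {i : I} (hi : i ∉ fbSelector γ f g G x) :
    ∀ᶠ y in 𝓝 x, addE f g x ≤ addE f (G i) y := by
  obtain ⟨j, hj⟩ := hg.exists_apply_eq x
  have htop := apply_ne_top_of_mem_fixSet hg hf hd hγ hx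
  obtain ⟨a, ha⟩ := exists_eq_coe (hj ▸ (hg.proper j).1 x) htop
  set z := forward γ f x with hz
  have hlt : moreau γ g z < moreau γ (G i) z := lt_of_le_of_ne (hg.moreau_le γ i z) hi
  rw [← show g x + ((1 / (2 * γ) * ‖z - x‖ ^ 2 : ℝ) : EReal) = moreau γ g z from hx, ha,
    ← EReal.coe_add] at hlt
  -- A real `c` in between is needed since the envelope of `G i` is not known to be finite here.
  obtain ⟨c, hc1, hc2⟩ := EReal.lt_iff_exists_real_btwn.1 hlt
  rw [EReal.coe_lt_coe_iff] at hc1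
  have hcf := hd.continuous
  have hcont : Continuous fun y => f y + c - 1 / (2 * γ) * ‖z - y‖ ^ 2 := by fun_prop
  have hev := (hcont.tendsto x).eventually (lt_mem_nhds (a := f x + a) (by linarith))
  filter_upwards [hev] with y hy
  simp only [addE, ha]
  rw [← EReal.coe_add]
  induction hb : G i y with
  | bot => exact absurd hb ((hg.proper i).1 y)
  | top => simp
  | coe b =>
    have h1 : moreau γ (G i) z ≤ _ := iInf_le _ y
    have h2 := hc2.le.trans h1
    rw [hb, ← EReal.coe_add, EReal.coe_le_coe_iff] at h2
    rw [← EReal.coe_add, EReal.coe_le_coe_iff]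
    linarith

theorem isLocalMinimum_addE (hg : IsMinConvexRepr g G) (hf : ConvexOn ℝ Set.univ f)
    (hd : Differentiable ℝ f) (hγ : 0 < γ) {x : X} (hx : x ∈ fixSet (fbOperator γ f g))
    (hev : ∀ᶠ y in 𝓝 x, addE f g x ≤ addE f g y) : IsLocalMinimum (addE f g) x :=
  ⟨(EReal.add_lt_top (EReal.coe_ne_top _) (apply_ne_top_of_mem_fixSet hg hf hd hγ hx)).ne, hev⟩

variable [FiniteDimensional ℝ X]

theorem isOscAt_fbSelector {L : ℝ≥0} (hg : IsMinConvexRepr g G)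
    (hL : LipschitzWith L (gradient f)) (hγ : 0 < γ) (x : X) :
    IsOscAt (fbSelector γ f g G) x := by
  intro u v i hu hv hmem
  have hcont : ∀ j, Tendsto (fun n => moreau γ (G j) (forward γ f (u n))) atTop
      (𝓝 (moreau γ (G j) (forward γ f x))) := fun j =>
    (((continuous_moreau hγ (hg.proper j) (hg.lsc j) (hg.convex j)).comp
      (continuous_forward hL γ)).tendsto x).comp hu
  obtain ⟨j, hj⟩ := hg.exists_moreau_eq γ (forward γ f x)
  refine le_antisymm (hg.moreau_le γ i _) (hj ▸ le_of_tendsto_of_tendsto (hcont i) (hcont j) ?_)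
  filter_upwards [hv] with n hn
  have h1 : moreau γ g (forward γ f (u n)) = moreau γ (G i) (forward γ f (u n)) := hn ▸ hmem n
  exact h1 ▸ hg.moreau_le γ j _

theorem isUnionAveragedRepr_fbOperator {L : ℝ≥0} (hg : IsMinConvexRepr g G)
    (hf : ConvexOn ℝ Set.univ f) (hd : Differentiable ℝ f) (hL : LipschitzWith L (gradient f))
    (hγ : 0 < γ) (hγL : γ * L < 2) {P : I → X → X} (hP : ∀ i x, prox γ (G i) x = {P i x}) :
    IsUnionAveragedRepr (2 / (4 - γ * L)) (fbOperator γ f g)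
      (fun i x => P i (forward γ f x)) (fbSelector γ f g G) where
  finite := hg.finite
  averaged i := isAveraged_prox_forward hf hd hL hγ hγL (hg.proper i) (hg.convex i)
    fun x => by simp [hP i x]
  osc := isOscAt_fbSelector hg hL hγ
  nonempty := fbSelector_nonempty hg
  eq_image x := by
    ext p
    rw [mem_fbOperator_iff hg, Set.mem_image]
    simp only [hP, Set.mem_singleton_iff, eq_comm]

theorem mem_strongFixSet_fbOperator_iff (hg : IsMinConvexRepr g G)
    (hf : ConvexOn ℝ Set.univ f) (hd : Differentiable ℝ f) (hγ : 0 < γ) {x : X} :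
    x ∈ strongFixSet (fbOperator γ f g) ↔
      ∀ i ∈ fbSelector γ f g G x, x ∈ argmin (addE f (G i)) := by
  choose P hP using fun i =>
    exists_prox_eq_singleton hγ (hg.proper i) (hg.lsc i) (hg.convex i)
  have h1 : ∀ i, x ∈ argmin (addE f (G i)) ↔ x = P i (forward γ f x) := fun i => by
    rw [← mem_prox_forward_iff_argmin hf hd hγ (hg.proper i) (hg.convex i), hP,
      Set.mem_singleton_iff]
  have h2 : ∀ p, p ∈ fbOperator γ f g x ↔
      ∃ i ∈ fbSelector γ f g G x, p = P i (forward γ f x) := fun p => by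
    simp only [mem_fbOperator_iff hg, hP, Set.mem_singleton_iff]
  simp only [h1]
  constructor
  · intro hx i hi
    have h3 : P i (forward γ f x) ∈ fbOperator γ f g x := (h2 _).2 ⟨i, hi, rfl⟩
    rw [show fbOperator γ f g x = {x} from hx] at h3
    exact h3.symm
  · intro hx
    obtain ⟨i, hi⟩ := fbSelector_nonempty (γ := γ) (f := f) hg x
    refine Set.eq_singleton_iff_unique_mem.2 ⟨(h2 x).2 ⟨i, hi, hx i hi⟩, fun p hp => ?_⟩
    obtain ⟨j, hj, rfl⟩ := (h2 p).1 hp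
    exact (hx j hj).symm

/-- At a strong fixed point, `f + g` has a local minimum: the active pieces have a global one,
and the inactive pieces are larger nearby. -/
theorem eventually_addE_le_of_mem_strongFixSet (hg : IsMinConvexRepr g G)
    (hf : ConvexOn ℝ Set.univ f) (hd : Differentiable ℝ f) (hγ : 0 < γ) {x : X}
    (hx : x ∈ strongFixSet (fbOperator γ f g)) :
    ∀ᶠ y in 𝓝 x, addE f g x ≤ addE f g y := by
  have := hg.finite
  have hev : ∀ i, ∀ᶠ y in 𝓝 x, addE f g x ≤ addE f (G i) y := by
    intro i
    by_cases hi : i ∈ fbSelector γ f g G x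
    · have hmin := (mem_strongFixSet_fbOperator_iff hg hf hd hγ).1 hx i hi
      refine .of_forall fun y => ?_
      have h1 := hmin y
      simp only [addE] at h1 ⊢
      rwa [apply_eq_of_mem_argmin hg hf hd hγ hi hmin]
    · exact eventually_le_addE_of_notMem_fbSelector hg hf hd hγ (strongFixSet_subset_fixSet hx) hi
  filter_upwards [eventually_all.2 hev] with y hy
  obtain ⟨j, hj⟩ := hg.exists_apply_eq y
  have h1 := hy j
  simp only [addE] at h1 ⊢
  rwa [hj]

/-- Fixed points near a strong fixed point `xs` share an active piece with `xs`, hence the value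
of `f + g`, which is minimal near `xs`. -/
theorem exists_closedBall_isLocalMinimum {L : ℝ≥0} (hg : IsMinConvexRepr g G)
    (hf : ConvexOn ℝ Set.univ f) (hd : Differentiable ℝ f) (hL : LipschitzWith L (gradient f))
    (hγ : 0 < γ) {xs : X} (hxs : xs ∈ strongFixSet (fbOperator γ f g)) :
    ∃ δ > (0 : ℝ), fixSet (fbOperator γ f g) ∩ Metric.closedBall xs δ ⊆
      {x | IsLocalMinimum (addE f g) x} := by
  have := hg.finite
  have hev := (eventually_addE_le_of_mem_strongFixSet hg hf hd hγ hxs).eventually_nhds.and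
    (isOscAt_fbSelector hg hL hγ xs).eventually_subset
  obtain ⟨δ, hδ, hball⟩ := Metric.nhds_basis_closedBall.eventually_iff.1 hev
  refine ⟨δ, hδ, fun x ⟨hx, hxδ⟩ => isLocalMinimum_addE hg hf hd hγ hx ?_⟩
  obtain ⟨hloc, hsub⟩ := hball hxδ
  obtain ⟨i, hi, hmin⟩ := (mem_fixSet_fbOperator_iff hg hf hd hγ).1 hx
  have hmins := (mem_strongFixSet_fbOperator_iff hg hf hd hγ).1 hxs i (hsub hi)
  have hle : addE f g x ≤ addE f g xs := by
    have h1 := hmin xs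
    simp only [addE] at h1 ⊢
    rwa [apply_eq_of_mem_argmin hg hf hd hγ hi hmin,
      apply_eq_of_mem_argmin hg hf hd hγ (hsub hi) hmins]
  filter_upwards [hloc] with y hy using hle.trans hy

end ForwardBackward

theorem IsUnionAveragedRepr.isUnionAveraged {X : Type*} [NormedAddCommGroup X] {I : Type*} {α : ℝ}
    {T : X → Set X} {S : I → X → X} {φ : X → Set I} (h : IsUnionAveragedRepr α T S φ) :
    IsUnionAveraged α T := by
  have := h.finite
  obtain ⟨m, ⟨e⟩⟩ := Finite.exists_equiv_fin I
  refine ⟨m, fun k => S (e.symm k), fun x => e.symm ⁻¹' φ x,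
    ⟨inferInstance, fun k => h.averaged _, fun x u v k hu hv hmem => ?_, fun x => ?_, fun x => ?_⟩⟩
  · exact h.osc x u (fun n => e.symm (v n)) (e.symm k) hu
      (hv.mono fun n hn => congrArg e.symm hn) hmem
  · exact (h.nonempty x).preimage e.symm.surjective
  · rw [h.eq_image x]
    conv_lhs => rw [← Set.image_preimage_eq (φ x) e.symm.surjective, Set.image_image]

end UnionAveraged

theorem theorem6p12 {X : Type*} [NormedAddCommGroup X] [InnerProductSpace ℝ X]
    [CompleteSpace X] [FiniteDimensional ℝ X]
    (f : X → ℝ) (L : ℝ≥0) (hf_convex : ConvexOn ℝ Set.univ f) (hf_diff : Differentiable ℝ f)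
    (hf_lip : LipschitzWith L (gradient f))
    {I : Type*} (g : X → EReal) (G : I → X → EReal) (hg : IsMinConvexRepr g G)
    (γ : ℝ) (hγ_pos : 0 < γ) (hγ_lt : γ * L < 2) :
    -- the operator is union averaged, with an explicit representation
    IsUnionAveraged (2 / (4 - γ * L)) (fbOperator γ f g) ∧
    (∃ P : I → X → X, (∀ i x, prox γ (G i) x = {P i x}) ∧
      IsUnionAveragedRepr (2 / (4 - γ * L)) (fbOperator γ f g)
        (fun i x => P i (forward γ f x)) (fbSelector γ f g G)) ∧
    -- fixed points are critical
    (∀ x ∈ fixSet (fbOperator γ f g), ∃ i,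
      (0 : X) ∈ ({gradient f x} + proxSubdiff g x) ∩ ({gradient f x} + subdiff (G i) x)) ∧
    -- characterization of fixed points
    (∀ x, (x ∈ fixSet (fbOperator γ f g) ↔
        ∃ i ∈ fbSelector γ f g G x, x ∈ argmin (addE f (G i))) ∧
      ∀ i ∈ fbSelector γ f g G x, x ∈ argmin (addE f (G i)) → g x = G i x) ∧
    -- characterization of strong fixed points
    (∀ x, (x ∈ strongFixSet (fbOperator γ f g) ↔
        ∀ i ∈ fbSelector γ f g G x, x ∈ argmin (addE f (G i))) ∧
      (x ∈ strongFixSet (fbOperator γ f g) → ∀ i ∈ fbSelector γ f g G x, g x = G i x)) ∧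
    -- strong fixed points are local minima
    strongFixSet (fbOperator γ f g) ⊆
      {x | IsLocalMinimum (addE f g) x} ∩ fixSet (fbOperator γ f g) ∧
    -- fixed points near a strong fixed point are local minima
    (∀ xs ∈ strongFixSet (fbOperator γ f g), ∃ δ > (0 : ℝ),
      fixSet (fbOperator γ f g) ∩ Metric.closedBall xs δ ⊆
        {x | IsLocalMinimum (addE f g) x}) ∧
    -- convergence of the relaxed iteration, for every representation of the operator
    (∀ xs ∈ strongFixSet (fbOperator γ f g), ∃ δ > (0 : ℝ≥0∞),
      ∀ (K : Type*) (S : K → X → X) (φ : X → Set K),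
        IsUnionAveragedRepr (2 / (4 - γ * L)) (fbOperator γ f g) S φ →
        0 < attractionRadius φ xs ∧
        ∀ (lam : ℕ → ℝ) (x : ℕ → X),
          (∀ n, lam n ∈ Set.Ioc 0 ((4 - γ * L) / 2)) →
          0 < liminf (fun n => lam n * ((4 - γ * L) / 2 - lam n)) atTop →
          (∀ n, x (n + 1) ∈ {(1 - lam n) • x n} + lam n • fbOperator γ f g (x n)) →
          edist (x 0) xs < attractionRadius φ xs →
          ∃ xbar ∈ fixSet (fbOperator γ f g),
            edist xbar xs ≤ attractionRadius φ xs ∧ Tendsto x atTop (𝓝 xbar) ∧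
            (edist (x 0) xs < δ → IsLocalMinimum (addE f g) xbar)) := by
  choose P hP using fun i =>
    exists_prox_eq_singleton hγ_pos (hg.proper i) (hg.lsc i) (hg.convex i)
  have hrepr := isUnionAveragedRepr_fbOperator hg hf_convex hf_diff hf_lip hγ_pos hγ_lt hP
  refine ⟨hrepr.isUnionAveraged, ⟨P, hP, hrepr⟩, fun x hx => ?_,
    fun x => ⟨mem_fixSet_fbOperator_iff hg hf_convex hf_diff hγ_pos,
      fun i hi => apply_eq_of_mem_argmin hg hf_convex hf_diff hγ_pos hi⟩,
    fun x => ⟨mem_strongFixSet_fbOperator_iff hg hf_convex hf_diff hγ_pos, fun hx i hi =>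
      apply_eq_of_mem_argmin hg hf_convex hf_diff hγ_pos hi
        ((mem_strongFixSet_fbOperator_iff hg hf_convex hf_diff hγ_pos).1 hx i hi)⟩,
    fun x hx => ⟨isLocalMinimum_addE hg hf_convex hf_diff hγ_pos (strongFixSet_subset_fixSet hx)
      (eventually_addE_le_of_mem_strongFixSet hg hf_convex hf_diff hγ_pos hx),
      strongFixSet_subset_fixSet hx⟩,
    fun xs hxs => exists_closedBall_isLocalMinimum hg hf_convex hf_diff hf_lip hγ_pos hxs,
    fun xs hxs => ?_⟩
  · obtain ⟨i, -, hmin⟩ := (mem_fixSet_fbOperator_iff hg hf_convex hf_diff hγ_pos).1 hx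
    have hbot : ∀ y, g y ≠ ⊥ := fun y => by
      obtain ⟨j, hj⟩ := hg.exists_apply_eq y
      exact hj ▸ (hg.proper j).1 y
    refine ⟨i, Set.mem_add.2 ⟨_, rfl, _, neg_gradient_mem_proxSubdiff hγ_pos hx
        (apply_ne_top_of_mem_fixSet hg hf_convex hf_diff hγ_pos hx) hbot, add_neg_cancel _⟩,
      Set.mem_add.2 ⟨_, rfl, _, (mem_argmin_addE_iff hf_convex (hg.proper i) (hg.convex i)
        (hf_diff x).hasGradientAt).1 hmin, add_neg_cancel _⟩⟩
  · obtain ⟨δ, hδ, hball⟩ :=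
      exists_closedBall_isLocalMinimum hg hf_convex hf_diff hf_lip hγ_pos hxs
    refine ⟨ENNReal.ofReal δ, ENNReal.ofReal_pos.2 hδ, fun K S φ hS => ?_⟩
    have := hS.finite
    refine ⟨attractionRadius_pos (hS.osc xs), fun lam x hlam hliminf hx hx0 => ?_⟩
    simp only [← inv_div (2 : ℝ)] at hlam hliminf
    obtain ⟨y, hy, hyd, htend⟩ := hS.exists_tendsto_fixSet hxs hlam hliminf hx hx0
    refine ⟨y, hy, hyd.trans hx0.le, htend, fun hx0δ => hball ⟨hy, ?_⟩⟩
    have h1 := hyd.trans_lt hx0δ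
    rw [edist_dist, ENNReal.ofReal_lt_ofReal_iff hδ] at h1
    exact h1.le
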